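/- Let $\mathcal{C}at$ and $\mathcal{CAT}$ denote the 2-categories of small and of (possibly large) categories, and let $\mathbb 1$ be the terminal category. A \emph{derivator} is a 2-functor (strict, or more generally a pseudofunctor) $\mathscr D\colon \mathcal{C}at^{\mathrm{op}}\to\mathcal{CAT}$, written $u\mapsto u^*$ on functors, such that (Der1) $\mathscr D$ takes coproducts to products: for every small family $(A_i)$ the canonical functor $\mathscr D(\coprod_i A_i)\to\prod_i\mathscr D(A_i)$ is an equivalence; (Der2) for every $A$ the functors $a^*\colon\mathscr D(A)\to\mathscr D(\mathbb 1)$, for $a\colon \mathbb 1\to A$ ranging over the objects of $A$, are jointly conservative; (Der3) every $u^*$ has a left adjoint $u_!$ and a right adjoint $u_*$; (Der4) for $u\colon A\to C$ and $v\colon B\to C$ with comma category $(u/v)$ and projections $p\colon(u/v)\to A$, $q\colon(u/v)\to B$, the canonical mate $q_!p^*\to v^*u_!$ is an isomorphism if $B=\mathbb 1$, and the canonical mate $u^*v_*\to p_*q^*$ is an isomorphism if $A=\mathbb 1$. Let $\Box=\{0<1\}\times\{0<1\}$. An object $X\in\mathscr D(\Box)$ is \emph{cocartesian} if it lies in the essential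 image of $i_!$ for the inclusion $i\colon\Box\setminus\{(1,1)\}\hookrightarrow\Box$, and \emph{cartesian} if it lies in the essential image of $j_*$ for the inclusion $j\colon\Box\setminus\{(0,0)\}\hookrightarrow\Box$. A derivator is \emph{$\Sigma$-stable} if $\mathscr D(\mathbb 1)$ has a zero object and every $X\in\mathscr D(\Box)$ for which $(0,1)^*X$ and $(1,0)^*X$ are zero objects is cartesian if and only if it is cocartesian. \textbf{Lemma.} Every $\Sigma$-stable derivator $\mathscr D$ is additive, in the sense that finite products and coproducts coincide naturally: for every small category $A$, the category $\mathscr D(A)$ has a zero object, finite products and finite coproducts, and for every finite set $J$ the canonical natural transformation $$\coprod_{i\in J}X_i\longrightarrow\prod_{j\in J}X_j$$ between functors $\mathscr D(A)^J\to\mathscr D(A)$, whose component $X_i\to X_j$ is the identity if $i=j$ and the zero morphism if $i\neq j$, is an isomorphism. -/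

import Mathlib

open CategoryTheory CategoryTheory.Limits

universe w v u

namespace Derivators

noncomputable section

/-! ### Prederivators and restriction functors -/

set_option linter.checkUnivs false in
/-- A prederivator: a 2-functor `Catᵒᵖ ⥤ CAT` contravariant on 1-cells and covariant on
2-cells, where `Cat.{w, w}` is the 2-category of small categories.  It is allowed to be a
pseudofunctor; strict 2-functors are a special case. -/
abbrev Prederivator : Type _ := Pseudofunctor Cat.{w, w}ᵒᵖ Cat.{v, u}

/-- The category `D(A)` of coherent `A`-shaped diagrams. -/
abbrev Prederivator.diag (D : Prederivator.{w, v, u}) (A : Type w) [SmallCategory A] : Type u :=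
  (D.obj (Opposite.op (Cat.of A)) : Cat.{v, u})

section Restriction

variable (D : Prederivator.{w, v, u})
  {A B C E : Type w} [SmallCategory A] [SmallCategory B] [SmallCategory C] [SmallCategory E]

/-- Restriction `p^* : D(B) ⥤ D(A)` along a functor `p : A ⥤ B`. -/
def Prederivator.res (p : A ⥤ B) : D.diag B ⥤ D.diag A :=
  (D.map p.toCatHom.op).toFunctor

/-- The transformation `p^* ⟶ q^*` induced by a natural transformation `p ⟶ q`. -/
def Prederivator.resMap {p q : A ⥤ B} (α : p ⟶ q) : D.res p ⟶ D.res q :=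
  (D.map₂ (Bicategory.Opposite.op2 α.toCatHom₂)).toNatTrans

/-- The structural isomorphism `(p ⋙ q)^* ≅ q^* ⋙ p^*`. -/
def Prederivator.resComp (p : A ⥤ B) (q : B ⥤ C) : D.res (p ⋙ q) ≅ D.res q ⋙ D.res p :=
  Cat.Hom.toNatIso (D.mapComp q.toCatHom.op p.toCatHom.op)

/-- The square `α^* : p^* u^* ⟶ q^* v^*` induced by a square `α : u p ⟶ v q` of small
categories. -/
def Prederivator.resSquare {p : E ⥤ A} {q : E ⥤ B} {f : A ⥤ C} {g : B ⥤ C}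
    (α : p ⋙ f ⟶ q ⋙ g) : TwoSquare (D.res f) (D.res g) (D.res p) (D.res q) :=
  TwoSquare.mk _ _ _ _ ((D.resComp p f).inv ≫ D.resMap α ≫ (D.resComp q g).hom)

end Restriction

/-- The terminal category, as a small category. -/
abbrev One : Type w := Discrete PUnit.{w + 1}

/-- The functor `𝟙 ⥤ A` with value `a`. -/
abbrev pt {A : Type w} [SmallCategory A] (a : A) : One.{w} ⥤ A := Functor.fromPUnit a

/-- Evaluation `X ↦ X_a` of coherent diagrams at an object `a`. -/
abbrev Prederivator.eval (D : Prederivator.{w, v, u}) {A : Type w} [SmallCategory A] (a : A) :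
    D.diag A ⥤ D.diag One.{w} :=
  D.res (pt a)

/-! ### Derivators -/

/-- Axiom (Der3): all restriction functors have left and right adjoints. -/
class HasKanExtensions (D : Prederivator.{w, v, u}) : Prop where
  isRightAdjoint {A B : Type w} [SmallCategory A] [SmallCategory B] (p : A ⥤ B) :
    (D.res p).IsRightAdjoint
  isLeftAdjoint {A B : Type w} [SmallCategory A] [SmallCategory B] (p : A ⥤ B) :
    (D.res p).IsLeftAdjoint

attribute [instance] HasKanExtensions.isRightAdjoint HasKanExtensions.isLeftAdjoint

section Kan

variable (D : Prederivator.{w, v, u}) [HasKanExtensions D]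
  {A B C E : Type w} [SmallCategory A] [SmallCategory B] [SmallCategory C] [SmallCategory E]

/-- The left Kan extension functor `p_!`. -/
def lan (p : A ⥤ B) : D.diag A ⥤ D.diag B := (D.res p).leftAdjoint

/-- The right Kan extension functor `p_*`. -/
def ran (p : A ⥤ B) : D.diag A ⥤ D.diag B := (D.res p).rightAdjoint

/-- The adjunction `p_! ⊣ p^*`. -/
def lanAdj (p : A ⥤ B) : lan D p ⊣ D.res p := Adjunction.ofIsRightAdjoint (D.res p)

/-- The adjunction `p^* ⊣ p_*`. -/
def ranAdj (p : A ⥤ B) : D.res p ⊣ ran D p := Adjunction.ofIsLeftAdjoint (D.res p)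

/-- The mate `q_! p^* ⟶ g^* f_!` of the square induced by `α : f p ⟶ g q`. -/
def leftMate {p : E ⥤ A} {q : E ⥤ B} {f : A ⥤ C} {g : B ⥤ C} (α : p ⋙ f ⟶ q ⋙ g) :
    D.res p ⋙ lan D q ⟶ lan D f ⋙ D.res g :=
  ((mateEquiv (lanAdj D f) (lanAdj D q)).symm (D.resSquare α)).natTrans

/-- The mate `f^* g_* ⟶ p_* q^*` of the square induced by `α : f p ⟶ g q`. -/
def rightMate {p : E ⥤ A} {q : E ⥤ B} {f : A ⥤ C} {g : B ⥤ C} (α : p ⋙ f ⟶ q ⋙ g) :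
    ran D g ⋙ D.res f ⟶ D.res q ⋙ ran D p :=
  (mateEquiv (ranAdj D g) (ranAdj D p) (D.resSquare α)).natTrans

end Kan

/-- A derivator. -/
class IsDerivator (D : Prederivator.{w, v, u}) : Prop extends HasKanExtensions D where
  /-- (Der1) coproducts are sent to products: the canonical functor
  `D(∐ A_i) ⥤ ∏ D(A_i)` is an equivalence. -/
  der1 {I : Type w} (A : I → Type w) [∀ i, SmallCategory (A i)] :
    (Functor.pi' (fun i : I => D.res (Sigma.incl (C := A) i))).IsEquivalence
  /-- (Der2) the evaluation functors are jointly conservative. -/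
  der2 {A : Type w} [SmallCategory A] {X Y : D.diag A} (φ : X ⟶ Y)
    (h : ∀ a : A, IsIso ((D.eval a).map φ)) : IsIso φ
  /-- (Der4), left Kan extensions are pointwise. -/
  der4_left {A C : Type w} [SmallCategory A] [SmallCategory C] (f : A ⥤ C) (g : One.{w} ⥤ C) :
    IsIso (leftMate D (Comma.natTrans f g))
  /-- (Der4), right Kan extensions are pointwise. -/
  der4_right {B C : Type w} [SmallCategory B] [SmallCategory C] (f : One.{w} ⥤ C) (g : B ⥤ C) :
    IsIso (rightMate D (Comma.natTrans f g))

/-! ### Squares, pointed and `Σ`-stable derivators -/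

/-- The square `□ = 𝟚 × 𝟚`, a poset regarded as a small category. -/
abbrev Square : Type w := ULift.{w} (Fin 2 × Fin 2)

/-- The object `(i, j)` of the square. -/
abbrev sq (i j : Fin 2) : Square.{w} := ULift.up (i, j)

/-- The full subcategory `□ ∖ {(1,1)}` of the square. -/
abbrev UpperCorner : Type w := {x : Square.{w} // x ≠ sq 1 1}

/-- The full subcategory `□ ∖ {(0,0)}` of the square. -/
abbrev LowerCorner : Type w := {x : Square.{w} // x ≠ sq 0 0}

/-- The inclusion of `□ ∖ {(1,1)}` into the square. -/
def upperIncl : UpperCorner.{w} ⥤ Square.{w} :=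
  Monotone.functor (f := fun x : UpperCorner.{w} => x.1) (fun _ _ h => h)

/-- The inclusion of `□ ∖ {(0,0)}` into the square. -/
def lowerIncl : LowerCorner.{w} ⥤ Square.{w} :=
  Monotone.functor (f := fun x : LowerCorner.{w} => x.1) (fun _ _ h => h)

section Stable

variable (D : Prederivator.{w, v, u})

/-- A coherent square is cocartesian if it lies in the essential image of left Kan extension
from `□ ∖ {(1,1)}`. -/
def IsCocartesian [HasKanExtensions D] (X : D.diag Square.{w}) : Prop :=
  (lan D upperIncl.{w}).essImage X

/-- A coherent square is cartesian if it lies in the essential image of right Kan extension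
from `□ ∖ {(0,0)}`. -/
def IsCartesian [HasKanExtensions D] (X : D.diag Square.{w}) : Prop :=
  (ran D lowerIncl.{w}).essImage X

/-- A derivator is pointed if its underlying category has a zero object. -/
class IsPointed [IsDerivator D] : Prop where
  hasZeroObject : HasZeroObject (D.diag One.{w})

/-- A pointed derivator is `Σ`-stable if a coherent square whose two off-diagonal corners are
zero objects is cartesian if and only if it is cocartesian. -/
class IsSigmaStable [IsDerivator D] : Prop extends IsPointed D where
  cartesian_iff_cocartesian (X : D.diag Square.{w})
    (h01 : IsZero ((D.eval (sq 0 1)).obj X)) (h10 : IsZero ((D.eval (sq 1 0)).obj X)) :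
    IsCartesian D X ↔ IsCocartesian D X

end Stable

/-! ### Natural coincidence of finite products and coproducts -/

section Additive

variable (C : Type u) [Category.{v} C] (J : Type)

/-- The functor sending a family of objects to its coproduct. -/
@[simps]
def coproductFunctor [HasCoproductsOfShape J C] : (J → C) ⥤ C where
  obj X := ∐ X
  map φ := Limits.Sigma.map φ

/-- The functor sending a family of objects to its product. -/
@[simps]
def productFunctor [HasProductsOfShape J C] : (J → C) ⥤ C where
  obj X := ∏ᶜ X
  map φ := Limits.Pi.map φ

open Classical in
/-- The canonical natural map `∐ X ⟶ ∏ X` from the coproduct to the product of a family, whose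
components `X i ⟶ X j` are the identity for `i = j` and zero otherwise. -/
def coproductToProduct [HasZeroMorphisms C] [HasCoproductsOfShape J C] [HasProductsOfShape J C] :
    coproductFunctor C J ⟶ productFunctor C J where
  app X := Limits.Pi.lift (fun j => Limits.Sigma.π X j)
  naturality X Y φ := by
    change Limits.Sigma.map φ ≫ Limits.Pi.lift (fun j => Limits.Sigma.π Y j) =
      Limits.Pi.lift (fun j => Limits.Sigma.π X j) ≫ Limits.Pi.map φ
    apply Limits.Pi.hom_ext
    intro j
    apply Limits.Sigma.hom_ext
    intro i
    by_cases h : i = j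
    · subst h
      simp
    · simp [Limits.Sigma.ι_π_of_ne _ h, Limits.Sigma.ι_π_of_ne_assoc _ h]

end Additive

/-- Finite products and coproducts coincide naturally: there is a zero object, finite products
and coproducts exist, and the canonical natural map from finite coproducts to finite products
(formed with the zero morphisms that factor through a zero object) is an isomorphism. -/
structure FiniteProductsCoincide (C : Type u) [Category.{v} C] : Prop where
  hasZeroObject : HasZeroObject C
  hasFiniteProducts : HasFiniteProducts C
  hasFiniteCoproducts : HasFiniteCoproducts C
  isIso_coproductToProduct (J : Type) [Finite J] :
    letI : HasZeroMorphisms C := HasZeroObject.zeroMorphismsOfZeroObject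
    IsIso (coproductToProduct C J)

/-- A derivator is additive if in each of the categories `D(A)` finite products and coproducts
coincide naturally. -/
def IsAdditive (D : Prederivator.{w, v, u}) : Prop :=
  ∀ (A : Type w) [SmallCategory A], FiniteProductsCoincide (D.diag A)

end

end Derivators

/-!
A Σ-stable derivator is additive because suspensions carry a natural "addition of loops".

In a category with a zero object, finite products and finite coproducts, let `S` be an equivalence
such that each set `Hom (S X, Y)` has an operation, natural in `X` and `Y`, with the zero map as a
two-sided unit. Then the canonical map `S A ⨿ S B ⟶ S A ⨯ S B ≅ S (A ⨯ B)` is inverted by the sum of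
the maps `S (A ⨯ B) ⟶ S A ⟶ S A ⨿ S B` and `S (A ⨯ B) ⟶ S B ⟶ S A ⨿ S B`
(`isIso_coprodToProd_of_add`); neither associativity nor commutativity is needed. This is applied
to `S = Σ` on `D(𝟙)`. The categories `D(A)` follow by evaluating at the objects of `A`, and finite
families follow from pairs by writing the inverse as a sum over the family.

`Σ X` is the homotopy colimit of the span `(0 ⟵ X ⟶ 0)`, the extension by zero of `X` from the
apex. The squares with vanishing off-diagonal corners that are cocartesian are the
extensions to `□` of such spans, and the cartesian ones are the dual extensions of an object placed
at `(1,1)`; both classes are parametrised fully faithfully by `D(𝟙)`. Σ-stability says that they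
agree, so passing from the corner `(0,0)` to the corner `(1,1)`, which is `Σ`, is an equivalence
(`isEquivalence_suspension`).

For the operation, subdivide the span to `(0 ⟵ X ⟶ X ⟵ X ⟶ 0)`. This diagram is the restriction of
`(0 ⟵ X ⟶ 0)` along a functor `collapse` whose comma categories are contractible, so it has the same
maps to constant diagrams (`bijective_res_map_of_comma`). It maps to the restrictions
`(0 ⟵ X ⟶ 0 ⟵ 0 ⟶ 0)` and `(0 ⟵ 0 ⟶ 0 ⟵ X ⟶ 0)` of the span along `firstHalf` and `secondHalf`, hence
to their product. At every object one of the two factors vanishes, so by (Der2) the product is also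
the coproduct, out of which a pair of maps to a constant diagram assembles (`fenceSum`).
-/

namespace Derivators

/-! ### Coincidence of products and coproducts -/

section CoprodToProd

attribute [local simp] prod.lift_fst prod.lift_snd prod.lift_fst_assoc prod.lift_snd_assoc
  coprod.inl_desc coprod.inr_desc coprod.inl_desc_assoc coprod.inr_desc_assoc

variable {C : Type*} [Category* C] [HasZeroMorphisms C] [HasBinaryProducts C]
  [HasBinaryCoproducts C]

/-- The canonical map `X ⨿ Y ⟶ X ⨯ Y` given by the identity matrix. -/
noncomputable def coprodToProd (X Y : C) : X ⨿ Y ⟶ X ⨯ Y :=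
  coprod.desc (prod.lift (𝟙 X) 0) (prod.lift 0 (𝟙 Y))

@[simp]
lemma coprodToProd_fst (X Y : C) :
    coprodToProd X Y ≫ prod.fst = coprod.desc (𝟙 X) 0 := by
  ext <;> simp [coprodToProd]

@[simp]
lemma coprodToProd_snd (X Y : C) :
    coprodToProd X Y ≫ prod.snd = coprod.desc 0 (𝟙 Y) := by
  ext <;> simp [coprodToProd]

@[simp]
lemma inl_coprodToProd (X Y : C) : coprod.inl ≫ coprodToProd X Y = prod.lift (𝟙 X) 0 := by
  simp [coprodToProd]

@[simp]
lemma inr_coprodToProd (X Y : C) : coprod.inr ≫ coprodToProd X Y = prod.lift 0 (𝟙 Y) := by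
  simp [coprodToProd]

@[simp]
lemma inl_coprodToProd_assoc (X Y : C) {Z : C} (f : X ⨯ Y ⟶ Z) :
    coprod.inl ≫ coprodToProd X Y ≫ f = prod.lift (𝟙 X) 0 ≫ f := by
  rw [← Category.assoc, inl_coprodToProd]

@[simp]
lemma inr_coprodToProd_assoc (X Y : C) {Z : C} (f : X ⨯ Y ⟶ Z) :
    coprod.inr ≫ coprodToProd X Y ≫ f = prod.lift 0 (𝟙 Y) ≫ f := by
  rw [← Category.assoc, inr_coprodToProd]

lemma coprodToProd_naturality {X Y X' Y' : C} (f : X ⟶ X') (g : Y ⟶ Y') :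
    coprod.map f g ≫ coprodToProd X' Y' = coprodToProd X Y ≫ prod.map f g := by
  ext <;> simp

lemma isIso_coprodToProd_of_iso {X Y X' Y' : C} (e : X ≅ X') (e' : Y ≅ Y')
    [IsIso (coprodToProd X Y)] : IsIso (coprodToProd X' Y') := by
  have h := coprodToProd_naturality e.hom e'.hom
  rw [← IsIso.eq_inv_comp] at h
  rw [h]
  infer_instance

lemma isIso_coprodToProd_of_isZero_left {X Y : C} (h : IsZero X) :
    IsIso (coprodToProd X Y) := by
  refine ⟨prod.snd ≫ coprod.inr, ?_, ?_⟩
  · ext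
    · exact h.eq_of_src _ _
    · simp
  · ext
    · exact h.eq_of_tgt _ _
    · simp

lemma isIso_coprodToProd_of_isZero_right {X Y : C} (h : IsZero Y) :
    IsIso (coprodToProd X Y) := by
  refine ⟨prod.fst ≫ coprod.inl, ?_, ?_⟩
  · ext
    · simp
    · exact h.eq_of_src _ _
  · ext
    · simp
    · exact h.eq_of_tgt _ _

/-- A functor preserving zero morphisms, binary products and binary coproducts carries the canonical
map to the canonical map, up to isomorphism. -/
lemma isIso_map_coprodToProd_iff {E : Type*} [Category* E] [HasZeroMorphisms E]
    [HasBinaryProducts E] [HasBinaryCoproducts E] (F : C ⥤ E) [F.PreservesZeroMorphisms]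
    [PreservesLimitsOfShape (Discrete WalkingPair) F]
    [PreservesColimitsOfShape (Discrete WalkingPair) F] (X Y : C) :
    IsIso (F.map (coprodToProd X Y)) ↔ IsIso (coprodToProd (F.obj X) (F.obj Y)) := by
  have h : coprodComparison F X Y ≫ F.map (coprodToProd X Y) ≫ prodComparison F X Y =
      coprodToProd (F.obj X) (F.obj Y) := by
    ext <;> simp [← Functor.map_comp]
  rw [← h, isIso_comp_left_iff, isIso_comp_right_iff]

/-- If every object is, up to isomorphism, a value of an equivalence `S` for which the sets
`Hom (S X, Y)` carry an operation that has `0` as a two-sided unit and is natural in `X` and `Y`,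
then binary products and coproducts coincide. The inverse of the canonical map
`S A ⨿ S B ⟶ S A ⨯ S B ≅ S (A ⨯ B)` is the sum of the composites of the projections with the
coprojections. -/
lemma isIso_coprodToProd_of_add (S : C ⥤ C) [S.IsEquivalence]
    (add : ∀ {X Y : C}, (S.obj X ⟶ Y) → (S.obj X ⟶ Y) → (S.obj X ⟶ Y))
    (add_zero : ∀ {X Y : C} (f : S.obj X ⟶ Y), add f 0 = f)
    (zero_add : ∀ {X Y : C} (f : S.obj X ⟶ Y), add 0 f = f)
    (add_comp : ∀ {X Y Y' : C} (f g : S.obj X ⟶ Y) (h : Y ⟶ Y'),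
      add f g ≫ h = add (f ≫ h) (g ≫ h))
    (comp_add : ∀ {X X' Y : C} (k : X' ⟶ X) (f g : S.obj X ⟶ Y),
      S.map k ≫ add f g = add (S.map k ≫ f) (S.map k ≫ g)) (X Y : C) :
    IsIso (coprodToProd X Y) := by
  suffices h : ∀ A B : C, IsIso (coprodToProd (S.obj A) (S.obj B)) from
    isIso_coprodToProd_of_iso (S.objObjPreimageIso X) (S.objObjPreimageIso Y)
  intro A B
  let r : S.obj (A ⨯ B) ⟶ S.obj A ⨿ S.obj B :=
    add (S.map prod.fst ≫ coprod.inl) (S.map prod.snd ≫ coprod.inr)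
  have hr : r ≫ coprodToProd (S.obj A) (S.obj B) = prodComparison S A B := by
    ext
    · simp [r, add_comp, add_zero]
    · simp [r, add_comp, zero_add]
  have hl : coprod.inl ≫ coprodToProd (S.obj A) (S.obj B) =
      S.map (prod.lift (𝟙 A) 0) ≫ prodComparison S A B := by
    ext <;> simp [← Functor.map_comp]
  have hl' : coprod.inr ≫ coprodToProd (S.obj A) (S.obj B) =
      S.map (prod.lift 0 (𝟙 B)) ≫ prodComparison S A B := by
    ext <;> simp [← Functor.map_comp]
  refine ⟨inv (prodComparison S A B) ≫ r, ?_, by simp [hr]⟩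
  apply coprod.hom_ext
  · have h : S.map (prod.lift (𝟙 A) 0) ≫ r = coprod.inl := by
      simp only [r, comp_add, ← Category.assoc, ← Functor.map_comp]
      simp [add_zero]
    rw [← Category.assoc, hl]
    simpa using h
  · have h : S.map (prod.lift 0 (𝟙 B)) ≫ r = coprod.inr := by
      simp only [r, comp_add, ← Category.assoc, ← Functor.map_comp]
      simp [zero_add]
    rw [← Category.assoc, hl']
    simpa using h

/-- If the canonical maps are isomorphisms, then coproducts are biproducts. -/
lemma hasBinaryBiproducts_of_isIso_coprodToProd
    (h : ∀ X Y : C, IsIso (coprodToProd X Y)) : HasBinaryBiproducts C where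
  has_binary_biproduct X Y := by
    let b : BinaryBicone X Y :=
      { pt := X ⨿ Y
        fst := coprod.desc (𝟙 X) 0
        snd := coprod.desc 0 (𝟙 Y)
        inl := coprod.inl
        inr := coprod.inr }
    refine HasBinaryBiproduct.mk ⟨b, ?_, ?_⟩
    · have e : b.toCone ≅ BinaryFan.mk (prod.fst : X ⨯ Y ⟶ X) prod.snd :=
        BinaryFan.ext (@asIso _ _ _ _ (coprodToProd X Y) (h X Y)) (coprodToProd_fst X Y).symm
          (coprodToProd_snd X Y).symm
      exact IsLimit.ofIsoLimit (prodIsProd X Y) e.symm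
    · exact coprodIsCoprod X Y

end CoprodToProd

section Finite

attribute [local instance] SemiadditiveOfBinaryBiproducts.addCommMonoidHomOfHasBinaryBiproducts
  HasZeroObject.zeroMorphismsOfZeroObject

open SemiadditiveOfBinaryBiproducts in
/-- Binary biproducts induce commutative monoid structures on the sets of morphisms, so that
the inverse of `∐ X ⟶ ∏ X` can be written as the sum `∑ j, π j ≫ ι j`. -/
lemma finiteProductsCoincide_of_isIso_coprodToProd (C : Type u) [Category.{v} C] [HasZeroObject C]
    [HasFiniteProducts C] [HasFiniteCoproducts C]
    (h : ∀ X Y : C, IsIso (coprodToProd X Y)) : FiniteProductsCoincide C := by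
  have := hasBinaryBiproducts_of_isIso_coprodToProd h
  refine ⟨inferInstance, inferInstance, inferInstance, fun J _ => ?_⟩
  classical
  have := Fintype.ofFinite J
  let leftHom {X Y Z : C} (f : X ⟶ Y) : (Y ⟶ Z) →+ (X ⟶ Z) :=
    { toFun := fun g => f ≫ g
      map_zero' := comp_zero
      map_add' := comp_add f }
  let rightHom {X Y Z : C} (g : Y ⟶ Z) : (X ⟶ Y) →+ (X ⟶ Z) :=
    { toFun := fun f => f ≫ g
      map_zero' := zero_comp
      map_add' := fun f f' => add_comp f f' g }
  have comp_sum {X Y Z : C} (f : X ⟶ Y) (g : J → (Y ⟶ Z)) :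
      f ≫ ∑ j, g j = ∑ j, f ≫ g j := map_sum (leftHom f) g _
  have sum_comp {X Y Z : C} (f : J → (X ⟶ Y)) (g : Y ⟶ Z) :
      (∑ j, f j) ≫ g = ∑ j, f j ≫ g := map_sum (rightHom g) f _
  suffices ∀ X : J → C, IsIso ((coproductToProduct C J).app X) from
    NatIso.isIso_of_isIso_app _
  intro X
  change IsIso (Pi.lift fun j => Sigma.π X j)
  refine ⟨∑ j, Pi.π X j ≫ Sigma.ι X j, ?_, ?_⟩
  · apply Sigma.hom_ext
    intro i
    rw [comp_sum, comp_sum, Finset.sum_eq_single i]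
    · simp
    · intro j _ hj
      simp [Sigma.ι_π_of_ne_assoc _ hj.symm]
    · simp
  · apply Pi.hom_ext
    intro i
    rw [sum_comp, sum_comp, Finset.sum_eq_single i]
    · simp
    · intro j _ hj
      simp [Sigma.ι_π_of_ne _ hj]
    · simp

end Finite

/-- Two fully faithful functors with the same essential image differ by an equivalence; in the
presence of a retraction `R` of the second, this equivalence is given by `R`. -/
lemma isEquivalence_comp_of_essImage_eq {C E : Type*} [Category* C] [Category* E]
    (Q Q' : C ⥤ E) [Q.Full] [Q.Faithful] [Q'.Full] [Q'.Faithful]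
    (h : Q.essImage = Q'.essImage) (R : E ⥤ C) (e : Q' ⋙ R ≅ 𝟭 C) :
    (Q ⋙ R).IsEquivalence := by
  have e' : Q'.toEssImage ⋙ Q'.essImage.ι ⋙ R ≅ 𝟭 C :=
    (Functor.associator _ _ _).symm ≪≫ Functor.isoWhiskerRight Q'.toEssImageCompι R ≪≫ e
  have : (Q'.toEssImage ⋙ Q'.essImage.ι ⋙ R).IsEquivalence :=
    Functor.isEquivalence_of_iso e'.symm
  have hR : (Q'.essImage.ι ⋙ R).IsEquivalence :=
    Functor.isEquivalence_of_comp_left Q'.toEssImage _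
  rw [← h] at hR
  exact Functor.isEquivalence_of_iso
    ((Functor.associator _ _ _).symm ≪≫ Functor.isoWhiskerRight Q.toEssImageCompι R :
      Q.toEssImage ⋙ Q.essImage.ι ⋙ R ≅ Q ⋙ R)

/-! ### The calculus of restriction functors -/

section Restriction

variable (D : Prederivator.{w, v, u})
  {A B C E : Type w} [SmallCategory A] [SmallCategory B] [SmallCategory C] [SmallCategory E]

lemma resMap_id (p : A ⥤ B) : D.resMap (𝟙 p) = 𝟙 (D.res p) :=
  congrArg Cat.Hom₂.toNatTrans (D.map₂_id p.toCatHom.op)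

lemma resMap_comp {p q r : A ⥤ B} (α : p ⟶ q) (β : q ⟶ r) :
    D.resMap (α ≫ β) = D.resMap α ≫ D.resMap β :=
  congrArg Cat.Hom₂.toNatTrans
    (D.map₂_comp (Bicategory.Opposite.op2 α.toCatHom₂) (Bicategory.Opposite.op2 β.toCatHom₂))

/-- Isomorphic functors have isomorphic restriction functors. -/
@[simps]
def resMapIso {p q : A ⥤ B} (e : p ≅ q) : D.res p ≅ D.res q where
  hom := D.resMap e.hom
  inv := D.resMap e.inv
  hom_inv_id := by rw [← resMap_comp, e.hom_inv_id, resMap_id]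
  inv_hom_id := by rw [← resMap_comp, e.inv_hom_id, resMap_id]

instance isIso_resMap {p q : A ⥤ B} (α : p ⟶ q) [IsIso α] : IsIso (D.resMap α) :=
  inferInstanceAs (IsIso (resMapIso D (asIso α)).hom)

/-- The structural isomorphism `(𝟭 A)^* ≅ 𝟭 (D A)`. -/
noncomputable def resId (A : Type w) [SmallCategory A] : D.res (𝟭 A) ≅ 𝟭 (D.diag A) :=
  Cat.Hom.toNatIso (D.mapId (Opposite.op (Cat.of A)))

lemma resMap_whiskerRight {p q : A ⥤ B} (β : p ⟶ q) (f : B ⥤ C) :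
    D.resMap (Functor.whiskerRight β f) ≫ (D.resComp q f).hom =
      (D.resComp p f).hom ≫ Functor.whiskerLeft (D.res f) (D.resMap β) := by
  have h := congrArg Cat.Hom₂.toNatTrans
    (D.map₂_whisker_left f.toCatHom.op (Bicategory.Opposite.op2 β.toCatHom₂))
  rw [← Iso.eq_comp_inv, Category.assoc]
  exact h

lemma resMap_whiskerLeft (e : E ⥤ A) {p q : A ⥤ B} (β : p ⟶ q) :
    D.resMap (Functor.whiskerLeft e β) ≫ (D.resComp e q).hom =
      (D.resComp e p).hom ≫ Functor.whiskerRight (D.resMap β) (D.res e) := by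
  have h := congrArg Cat.Hom₂.toNatTrans
    (D.map₂_whisker_right (Bicategory.Opposite.op2 β.toCatHom₂) e.toCatHom.op)
  rw [← Iso.eq_comp_inv, Category.assoc]
  exact h

lemma isIso_resMap_app_res {p q : A ⥤ B} (β : p ⟶ q) (f : B ⥤ C)
    [IsIso (Functor.whiskerRight β f)] (X : D.diag C) :
    IsIso ((D.resMap β).app ((D.res f).obj X)) := by
  have h := congrArg (fun t => t.app X) (resMap_whiskerRight D β f)
  dsimp at h
  rw [← IsIso.inv_comp_eq] at h
  rw [← h]
  infer_instance

lemma isIso_res_map_resMap_app (e : E ⥤ A) {p q : A ⥤ B} (β : p ⟶ q)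
    [IsIso (Functor.whiskerLeft e β)] (X : D.diag B) :
    IsIso ((D.res e).map ((D.resMap β).app X)) := by
  have h := congrArg (fun t => t.app X) (resMap_whiskerLeft D e β)
  dsimp at h
  rw [← IsIso.inv_comp_eq] at h
  rw [← h]
  infer_instance

lemma isIso_res_comp_map_iff (p : A ⥤ B) (q : B ⥤ C) {X Y : D.diag C} (f : X ⟶ Y) :
    IsIso ((D.res (p ⋙ q)).map f) ↔ IsIso ((D.res p).map ((D.res q).map f)) :=
  NatIso.isIso_map_iff (D.resComp p q) f

lemma isIso_res_map_iff_of_iso {p q : A ⥤ B} (e : p ≅ q) {X Y : D.diag B} (f : X ⟶ Y) :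
    IsIso ((D.res p).map f) ↔ IsIso ((D.res q).map f) :=
  NatIso.isIso_map_iff (resMapIso D e) f

/-- An adjunction `l ⊣ r` of small categories, viewed in the opposite 2-category, where the roles
of the two functors are exchanged. -/
def opAdjunction {l : A ⥤ B} {r : B ⥤ A} (adj : l ⊣ r) :
    Bicategory.Adjunction r.toCatHom.op l.toCatHom.op where
  unit := Bicategory.Opposite.op2 adj.toCat.unit
  counit := Bicategory.Opposite.op2 adj.toCat.counit
  left_triangle := by
    have h := congrArg Bicategory.Opposite.op2 adj.toCat.right_triangle
    simpa [Bicategory.leftZigzag, Bicategory.rightZigzag, bicategoricalComp] using h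
  right_triangle := by
    have h := congrArg Bicategory.Opposite.op2 adj.toCat.left_triangle
    simpa [Bicategory.leftZigzag, Bicategory.rightZigzag, bicategoricalComp] using h

/-- A prederivator turns an adjunction `l ⊣ r` into an adjunction `r^* ⊣ l^*`. -/
noncomputable def resAdj {l : A ⥤ B} {r : B ⥤ A} (adj : l ⊣ r) : D.res r ⊣ D.res l :=
  Adjunction.ofCat (D.mapAdjunction (opAdjunction adj))

lemma resAdj_unit {l : A ⥤ B} {r : B ⥤ A} (adj : l ⊣ r) :
    (resAdj D adj).unit = (resId D A).inv ≫ D.resMap adj.unit ≫ (D.resComp l r).hom :=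
  rfl

instance isIso_resAdj_unit {l : A ⥤ B} {r : B ⥤ A} (adj : l ⊣ r) [IsIso adj.unit] :
    IsIso (resAdj D adj).unit := by
  rw [resAdj_unit]
  infer_instance

end Restriction

section Point

variable {A B : Type w} [SmallCategory A] [SmallCategory B]

instance isIso_natTrans_one {p q : A ⥤ One.{w}} (α : p ⟶ q) : IsIso α :=
  NatIso.isIso_of_isIso_app α

/-- An initial object, as a left adjoint of the functor to the terminal category. -/
def initialAdj (p : A ⥤ One.{w}) {a : A} (h : IsInitial a) : pt a ⊣ p where
  unit := { app := fun _ => Discrete.eqToHom (Subsingleton.elim _ _) }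
  counit :=
    { app := fun x => h.to x
      naturality := fun _ _ _ => h.hom_ext _ _ }
  left_triangle_components _ := h.hom_ext _ _

/-- A terminal object, as a right adjoint of the functor to the terminal category. -/
def terminalAdj (p : A ⥤ One.{w}) {a : A} (h : IsTerminal a) : p ⊣ pt a where
  unit :=
    { app := fun x => h.from x
      naturality := fun _ _ _ => h.hom_ext _ _ }
  counit := { app := fun _ => Discrete.eqToHom (Subsingleton.elim _ _) }
  right_triangle_components _ := h.hom_ext _ _

/-- The functor to the terminal category. -/
abbrev toOne (A : Type w) [SmallCategory A] : A ⥤ One.{w} := (Functor.const A).obj ⟨PUnit.unit⟩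

/-- Evaluating at `a` after restricting along `p` is evaluation at `p a`. -/
def ptComp (a : A) (p : A ⥤ B) : pt a ⋙ p ≅ pt (p.obj a) :=
  Discrete.natIso fun _ => Iso.refl _

/-- Two functors with values in the terminal category are isomorphic. -/
def isoOne (p q : A ⥤ One.{w}) : p ≅ q :=
  NatIso.ofComponents fun _ => Discrete.eqToIso (Subsingleton.elim _ _)

end Point

/-! ### Zero objects, finite products and finite coproducts -/

section Products

variable (D : Prederivator.{w, v, u})
  {A B : Type w} [SmallCategory A] [SmallCategory B]

section Kan

variable [HasKanExtensions D]

instance preservesLimitsOfShape_res (p : A ⥤ B) (J : Type*) [Category* J] :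
    PreservesLimitsOfShape J (D.res p) :=
  (lanAdj D p).rightAdjoint_preservesLimits.preservesLimitsOfShape

instance preservesColimitsOfShape_res (p : A ⥤ B) (J : Type*) [Category* J] :
    PreservesColimitsOfShape J (D.res p) :=
  (ranAdj D p).leftAdjoint_preservesColimits.preservesColimitsOfShape

lemma isZero_res_obj (p : A ⥤ B) {X : D.diag B} (h : IsZero X) : IsZero ((D.res p).obj X) where
  unique_to Y := ⟨⟨((ranAdj D p).homEquiv X Y).symm (h.to_ _)⟩, fun _ =>
    ((ranAdj D p).homEquiv X Y).injective (h.eq_of_src _ _)⟩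
  unique_from Y := ⟨⟨((lanAdj D p).homEquiv Y X) (h.from_ _)⟩, fun _ =>
    ((lanAdj D p).homEquiv Y X).symm.injective (h.eq_of_tgt _ _)⟩

end Kan

variable [IsDerivator D]

/-- The diagonal `D(A) ⥤ D(A)^J` is restriction along the codiagonal `∐_J A ⥤ A`, up to the
equivalence of (Der1). -/
noncomputable def constIso (J A : Type w) [SmallCategory A] :
    (D.res (Sigma.desc fun _ : J => 𝟭 A) ⋙
      Functor.pi' (fun i : J => D.res (Sigma.incl (C := fun _ : J => A) i))) ⋙
      (piEquivalenceFunctorDiscrete J (D.diag A)).functor ≅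
    Functor.const (Discrete J) :=
  NatIso.ofComponents (fun X => Discrete.natIso fun j =>
    ((D.resComp (Sigma.incl (C := fun _ : J => A) j.as) (Sigma.desc fun _ => 𝟭 A)).symm ≪≫
      resMapIso D (Sigma.inclDesc (fun _ => 𝟭 A) j.as) ≪≫ resId D A).app X)
    (fun {X Y} f => by
      ext j
      exact (((D.resComp (Sigma.incl (C := fun _ : J => A) j.as) (Sigma.desc fun _ => 𝟭 A)).symm ≪≫
        resMapIso D (Sigma.inclDesc (fun _ => 𝟭 A) j.as) ≪≫ resId D A).hom.naturality f))

lemma hasLimitsOfShape_discrete (J : Type w) : HasLimitsOfShape (Discrete J) (D.diag A) := by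
  have := IsDerivator.der1 (D := D) (fun _ : J => A)
  exact hasLimitsOfShape_iff_isLeftAdjoint_const.2
    (Functor.isLeftAdjoint_of_iso (constIso D J A))

lemma hasColimitsOfShape_discrete (J : Type w) : HasColimitsOfShape (Discrete J) (D.diag A) := by
  have := IsDerivator.der1 (D := D) (fun _ : J => A)
  exact hasColimitsOfShape_iff_isRightAdjoint_const.2
    (Functor.isRightAdjoint_of_iso (constIso D J A))

instance hasFiniteProducts_diag : HasFiniteProducts (D.diag A) where
  out n := by
    have := hasLimitsOfShape_discrete D (A := A) (ULift.{w} (Fin n))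
    exact hasLimitsOfShape_of_equivalence (Discrete.equivalence Equiv.ulift)

instance hasFiniteCoproducts_diag : HasFiniteCoproducts (D.diag A) where
  out n := by
    have := hasColimitsOfShape_discrete D (A := A) (ULift.{w} (Fin n))
    exact hasColimitsOfShape_of_equivalence (Discrete.equivalence Equiv.ulift)

instance hasZeroObject_diag [IsPointed D] : HasZeroObject (D.diag A) := by
  obtain ⟨X, hX⟩ := IsPointed.hasZeroObject (D := D)
  exact ⟨_, isZero_res_obj D (toOne A) hX⟩

/-- By (Der1) for the empty family, any two parallel coherent morphisms over the empty category are
equal. -/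
lemma hom_eq_of_isEmpty [IsEmpty A] {X Y : D.diag A} (f g : X ⟶ Y) : f = g := by
  let F : PEmpty.{w + 1} → Type w := fun _ => PUnit.{w + 1}
  let _ (i : PEmpty.{w + 1}) : SmallCategory (F i) := i.elim
  have := IsDerivator.der1 (D := D) F
  let r : (Σ i, F i) ⥤ A := Sigma.desc fun i => i.elim
  let s : A ⥤ (Σ i, F i) :=
    { obj := fun a => isEmptyElim a
      map := fun {a} => isEmptyElim a
      map_id := isEmptyElim
      map_comp := fun {a} => isEmptyElim a }
  let e : s ⋙ r ≅ 𝟭 A :=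
    NatIso.ofComponents (fun a => isEmptyElim a) (fun {a} => isEmptyElim a)
  have : (D.res r ⋙ D.res s).Faithful :=
    Functor.Faithful.of_iso ((D.resComp s r).symm ≪≫ resMapIso D e ≪≫ resId D A).symm
  have : (D.res r).Faithful := Functor.Faithful.of_comp (D.res r) (D.res s)
  apply (D.res r).map_injective
  apply (Functor.pi' fun i : PEmpty.{w + 1} => D.res (Sigma.incl (C := F) i)).map_injective
  funext i
  exact i.elim

end Products

/-! ### Pointwise right Kan extensions -/

section Ran

variable (D : Prederivator.{w, v, u}) [IsDerivator D]
  {A B C : Type w} [SmallCategory A] [SmallCategory B] [SmallCategory C]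

/-- The limit cone exhibiting the value at `k` of `g_* X` as the limit of `X` over the comma
category `(k/g)`. -/
noncomputable def ranCone (k : C) (g : B ⥤ C) (X : D.diag B) :
    (D.res (Comma.fst (pt k) g)).obj ((D.eval k).obj ((ran D g).obj X)) ⟶
      (D.res (Comma.snd (pt k) g)).obj X :=
  (D.resSquare (Comma.natTrans (pt k) g)).app _ ≫
    (D.res (Comma.snd (pt k) g)).map ((ranAdj D g).counit.app X)

/-- The universal property of the limit cone; this is a reformulation of (Der4). -/
lemma bijective_ranCone (k : C) (g : B ⥤ C) (X : D.diag B) (W : D.diag One.{w}) :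
    Function.Bijective (fun h : W ⟶ (D.eval k).obj ((ran D g).obj X) =>
      (D.res (Comma.fst (pt k) g)).map h ≫ ranCone D k g X) := by
  have := IsDerivator.der4_right (D := D) (pt k) g
  let m := (rightMate D (Comma.natTrans (pt k) g)).app X
  have hm : (D.res (Comma.fst (pt k) g)).map m ≫
      (ranAdj D (Comma.fst (pt k) g)).counit.app _ = ranCone D k g X :=
    mateEquiv_counit (ranAdj D g) (ranAdj D (Comma.fst (pt k) g))
      (D.resSquare (Comma.natTrans (pt k) g)) X
  have hb : Function.Bijective (fun h : W ⟶ (D.eval k).obj ((ran D g).obj X) => h ≫ m) :=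
    ⟨fun a b hab => (cancel_mono m).1 hab, fun b => ⟨b ≫ inv m, by simp⟩⟩
  convert ((ranAdj D (Comma.fst (pt k) g)).homEquiv W _).symm.bijective.comp hb using 2 with h
  simp [Adjunction.homEquiv_counit, ← hm]

end Ran

section RanApplications

variable (D : Prederivator.{w, v, u}) [IsDerivator D]
  {A B C : Type w} [SmallCategory A] [SmallCategory B] [SmallCategory C]

attribute [local instance] HasZeroObject.zeroMorphismsOfZeroObject

/-- Right Kan extension extends by zero: `g_* X` vanishes at every object admitting no map to an
object in the image of `g`. -/
lemma isZero_eval_ran [IsPointed D] (k : C) (g : B ⥤ C) [IsEmpty (Comma (pt k) g)]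
    (X : D.diag B) : IsZero ((D.eval k).obj ((ran D g).obj X)) := by
  rw [IsZero.iff_id_eq_zero]
  exact (bijective_ranCone D k g X _).1 (hom_eq_of_isEmpty D _ _)

/-- Left Kan extension from an object extends by zero. -/
lemma isZero_eval_lan_pt [IsPointed D] (k y : C) [IsEmpty (Comma (pt y) (pt k))]
    (X : D.diag One.{w}) : IsZero ((D.eval k).obj ((lan D (pt y)).obj X)) := by
  rw [IsZero.iff_id_eq_zero]
  apply ((ranAdj D (pt k)).homEquiv _ _).injective
  apply ((lanAdj D (pt y)).homEquiv _ _).injective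
  exact (isZero_eval_ran D y (pt k) _).eq_of_tgt _ _

/-- For `g` fully faithful, the identity of `g b` is initial in the comma category `(g b/g)`. -/
noncomputable def isInitialCommaMk (g : B ⥤ C) [g.Full] [g.Faithful] (b : B) :
    IsInitial (Comma.mk (L := pt (g.obj b)) (R := g) ⟨PUnit.unit⟩ b (𝟙 _)) :=
  IsInitial.ofUniqueHom
    (fun Y =>
      { left := Discrete.eqToHom (Subsingleton.elim _ _)
        right := g.preimage Y.hom })
    (fun Y m => by
      ext
      · exact Subsingleton.elim _ _
      · apply g.map_injective
        have := m.w
        simpa using this.symm)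

/-- The counit `g^* g_* X ⟶ X` of a fully faithful functor is an isomorphism at every object `b`,
since the comma category `(g b/g)` has an initial object. -/
lemma isIso_eval_map_counit (g : B ⥤ C) [g.Full] [g.Faithful] (X : D.diag B) (b : B) :
    IsIso ((D.eval b).map ((ranAdj D g).counit.app X)) := by
  let E := Comma (pt (g.obj b)) g
  let e : E := Comma.mk (L := pt (g.obj b)) (R := g) ⟨PUnit.unit⟩ b (𝟙 _)
  have he : IsInitial e := isInitialCommaMk g b
  let p : E ⥤ One.{w} := Comma.fst _ _
  let q : E ⥤ B := Comma.snd _ _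
  let adj := resAdj D (initialAdj p he)
  -- Transposing the limit cone along `p^* ⊣ e^*` gives an isomorphism.
  have h₁ : IsIso (adj.homEquiv _ _ (ranCone D (g.obj b) g X)) := by
    apply (isIso_iff_yoneda_map_bijective _).2
    intro W
    convert (adj.homEquiv W _).bijective.comp (bijective_ranCone D (g.obj b) g X W) using 2 with h
    exact (adj.homEquiv_naturality_left _ _).symm
  rw [Adjunction.homEquiv_unit, isIso_comp_left_iff, ranCone, Functor.map_comp] at h₁
  have h₂ : IsIso ((D.res (pt e)).map
      ((D.resSquare (Comma.natTrans (pt (g.obj b)) g)).app ((ran D g).obj X))) := by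
    have : IsIso (Functor.whiskerLeft (pt e) (Comma.natTrans (pt (g.obj b)) g)) := by
      have (x : One.{w}) : IsIso ((Functor.whiskerLeft (pt e)
          (Comma.natTrans (pt (g.obj b)) g)).app x) := inferInstanceAs (IsIso (𝟙 (g.obj b)))
      exact NatIso.isIso_of_isIso_app _
    have := isIso_res_map_resMap_app D (pt e) (Comma.natTrans (pt (g.obj b)) g)
      ((ran D g).obj X)
    simp only [Prederivator.resSquare, TwoSquare.mk, NatTrans.comp_app, Functor.map_comp]
    infer_instance
  have h₃ : IsIso ((D.res (pt e)).map ((D.res q).map ((ranAdj D g).counit.app X))) :=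
    (isIso_comp_left_iff _ _).1 h₁
  rw [← isIso_res_comp_map_iff] at h₃
  exact (isIso_res_map_iff_of_iso D (ptComp e q) _).1 h₃

instance isIso_ranAdj_counit (g : B ⥤ C) [g.Full] [g.Faithful] : IsIso (ranAdj D g).counit := by
  have (X : D.diag B) : IsIso ((ranAdj D g).counit.app X) :=
    IsDerivator.der2 _ (isIso_eval_map_counit D g X)
  exact NatIso.isIso_of_isIso_app _

/-- Right Kan extension along a fully faithful functor is fully faithful. -/
noncomputable def ranFullyFaithful (g : B ⥤ C) [g.Full] [g.Faithful] : (ran D g).FullyFaithful :=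
  (ranAdj D g).fullyFaithfulROfIsIsoCounit

/-- Left Kan extension along a fully faithful functor is fully faithful. -/
noncomputable def lanFullyFaithful (g : B ⥤ C) [g.Full] [g.Faithful] : (lan D g).FullyFaithful :=
  (Adjunction.Triple.mk (lanAdj D g) (ranAdj D g)).fullyFaithfulEquiv.symm (ranFullyFaithful D g)

end RanApplications

/-! ### Contractibility and cofinality -/

section Contraction

variable (D : Prederivator.{w, v, u}) {A : Type w} [SmallCategory A]

/-- Restrictions along homotopic endofunctors detect the same equalities of maps between constant
diagrams, since `β : s ⟶ t` becomes invertible on constant diagrams. -/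
lemma res_map_eq_iff_of_natTrans {p : A ⥤ One.{w}} {s t : A ⥤ A} (β : s ⟶ t)
    {X Y : D.diag One.{w}} (f g : (D.res p).obj X ⟶ (D.res p).obj Y) :
    (D.res s).map f = (D.res s).map g ↔ (D.res t).map f = (D.res t).map g := by
  have h₁ := isIso_resMap_app_res D β p X
  have h₂ := isIso_resMap_app_res D β p Y
  rw [← cancel_mono ((D.resMap β).app ((D.res p).obj Y)), (D.resMap β).naturality,
    (D.resMap β).naturality, cancel_epi]

/-- If the identity of `A` is linked to a constant functor by `𝟭 A ⟵ r ⟶ const`, then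
constant diagrams form a full subcategory of `D(A)`. -/
lemma bijective_res_map_of_contraction (p : A ⥤ One.{w}) (r : A ⥤ A) (m : A)
    (σ : r ⟶ 𝟭 A) (τ : r ⟶ p ⋙ pt m) (X Y : D.diag One.{w}) :
    Function.Bijective (fun f : X ⟶ Y => (D.res p).map f) := by
  -- A map of constant diagrams is determined by its value at `m`.
  have key {f g : (D.res p).obj X ⟶ (D.res p).obj Y}
      (h : (D.eval m).map f = (D.eval m).map g) : f = g := by
    have h₁ : (D.res (p ⋙ pt m)).map f = (D.res (p ⋙ pt m)).map g := by
      have h₂ : (D.res (pt m) ⋙ D.res p).map f = (D.res (pt m) ⋙ D.res p).map g :=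
        congrArg (D.res p).map h
      rw [← cancel_mono ((D.resComp p (pt m)).hom.app _), NatTrans.naturality,
        NatTrans.naturality, h₂]
    rw [← res_map_eq_iff_of_natTrans D τ, res_map_eq_iff_of_natTrans D σ] at h₁
    rw [← cancel_epi ((resId D A).hom.app _)]
    have h₂ := (resId D A).hom.naturality f
    have h₃ := (resId D A).hom.naturality g
    dsimp at h₂ h₃
    rw [← h₂, ← h₃, h₁]
  let e : D.res p ⋙ D.res (pt m) ≅ 𝟭 _ :=
    (D.resComp (pt m) p).symm ≪≫ resMapIso D (isoOne _ _) ≪≫ resId D _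
  have : (D.res p ⋙ D.res (pt m)).Faithful := Functor.Faithful.of_iso e.symm
  have : (D.res p ⋙ D.res (pt m)).Full := Functor.Full.of_iso e.symm
  refine ⟨fun f g h => (D.res p ⋙ D.res (pt m)).map_injective
    (congrArg (D.res (pt m)).map h), fun f => ?_⟩
  obtain ⟨g, hg⟩ := (D.res p ⋙ D.res (pt m)).map_surjective ((D.res (pt m)).map f)
  exact ⟨g, key hg⟩

end Contraction

section Cofinal

variable (D : Prederivator.{w, v, u}) [IsDerivator D]
  {A B : Type w} [SmallCategory A] [SmallCategory B]

/-- If constant diagrams over the comma categories `(k/c)` form full subcategories, then maps to a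
constant diagram can be computed after restriction along `c`. -/
lemma bijective_res_map_of_comma (c : A ⥤ B) (p : B ⥤ One.{w})
    (h : ∀ (k : B) (X Y : D.diag One.{w}),
      Function.Bijective (fun f : X ⟶ Y => (D.res (Comma.fst (pt k) c)).map f))
    (M : D.diag B) (Y : D.diag One.{w}) :
    Function.Bijective (fun f : M ⟶ (D.res p).obj Y => (D.res c).map f) := by
  let N := (D.res p).obj Y
  -- At `k`, the unit is the map from a constant object to its limit over the comma category `(k/c)`.
  have hη : IsIso ((ranAdj D c).unit.app N) := by
    apply IsDerivator.der2
    intro k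
    apply (isIso_iff_yoneda_map_bijective _).2
    intro W
    let P : Comma (pt k) c ⥤ One.{w} := Comma.fst (pt k) c
    let θ := (D.resSquare (Comma.natTrans (pt k) c)).app N
    have hθ : IsIso θ := by
      have := isIso_resMap_app_res D (Comma.natTrans (pt k) c) p Y
      simp only [θ, N, Prederivator.resSquare, TwoSquare.mk, NatTrans.comp_app]
      infer_instance
    have hcone : (D.res P).map ((D.eval k).map ((ranAdj D c).unit.app N)) ≫
        ranCone D k c ((D.res c).obj N) = θ := by
      have h₁ := NatTrans.naturality (D.resSquare (Comma.natTrans (pt k) c))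
        ((ranAdj D c).unit.app N)
      have h₂ := congrArg (D.res (Comma.snd (pt k) c)).map
        ((ranAdj D c).left_triangle_components N)
      dsimp at h₁ h₂
      rw [Functor.map_comp, CategoryTheory.Functor.map_id] at h₂
      rw [ranCone, ← Category.assoc, h₁, Category.assoc, h₂, Category.comp_id]
    rw [← Function.Bijective.of_comp_iff' (bijective_ranCone D k c ((D.res c).obj N) W)]
    have hb := (isIso_iff_yoneda_map_bijective θ).1 hθ ((D.res P).obj W)
    refine Eq.subst (motive := Function.Bijective) (funext fun g => ?_) (hb.comp (h k W _))
    change (D.res P).map g ≫ θ = (D.res P).map (g ≫ _) ≫ ranCone D k c ((D.res c).obj N)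
    rw [← hcone, Functor.map_comp, Category.assoc]
  have hb := (isIso_iff_yoneda_map_bijective ((ranAdj D c).unit.app N)).1 hη M
  refine Eq.subst (motive := Function.Bijective) (funext fun f => ?_)
    (((ranAdj D c).homEquiv M _).symm.bijective.comp hb)
  have h₁ := (ranAdj D c).left_triangle_components N
  simp only [Function.comp_apply, Adjunction.homEquiv_counit, Functor.map_comp, Category.assoc]
  exact (congrArg _ h₁).trans (Category.comp_id _)

end Cofinal

/-! ### Suspension is an equivalence -/

section Suspension

variable (D : Prederivator.{w, v, u}) [IsDerivator D]
  {A B : Type w} [SmallCategory A] [SmallCategory B]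

/-- The value of `g_! X` at an object in the image of a fully faithful functor `g`. -/
noncomputable def lanEvalIso (g : A ⥤ B) [g.Full] [g.Faithful] (a : A) :
    lan D g ⋙ D.eval (g.obj a) ≅ D.eval a :=
  haveI := (lanFullyFaithful D g).full
  haveI := (lanFullyFaithful D g).faithful
  Functor.isoWhiskerLeft (lan D g) ((resMapIso D (ptComp a g)).symm ≪≫ D.resComp (pt a) g) ≪≫
    (Functor.associator _ _ _).symm ≪≫
    Functor.isoWhiskerRight (asIso (lanAdj D g).unit).symm (D.eval a) ≪≫ Functor.leftUnitor _

/-- The value of `g_* X` at an object in the image of a fully faithful functor `g`. -/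
noncomputable def ranEvalIso (g : A ⥤ B) [g.Full] [g.Faithful] (a : A) :
    ran D g ⋙ D.eval (g.obj a) ≅ D.eval a :=
  Functor.isoWhiskerLeft (ran D g) ((resMapIso D (ptComp a g)).symm ≪≫ D.resComp (pt a) g) ≪≫
    (Functor.associator _ _ _).symm ≪≫
    Functor.isoWhiskerRight (asIso (ranAdj D g).counit) (D.eval a) ≪≫ Functor.leftUnitor _

lemma isIso_of_isZero {C : Type*} [Category* C] {X Y : C} (hX : IsZero X) (hY : IsZero Y)
    (f : X ⟶ Y) : IsIso f :=
  ⟨hY.to_ X, hX.eq_of_src _ _, hY.eq_of_src _ _⟩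

/-- A coherent diagram vanishing away from `x` is the extension by zero of its value at `x`, if `x`
receives no maps from other objects. -/
lemma essImage_ran_pt [IsPointed D] (x : A) [(pt x).Full] [(pt x).Faithful]
    (hx : ∀ a, a ≠ x → IsEmpty (Comma (pt a) (pt x))) (G : D.diag A)
    (h : ∀ a, a ≠ x → IsZero ((D.eval a).obj G)) : (ran D (pt x)).essImage G := by
  have : IsIso ((ranAdj D (pt x)).unit.app G) := by
    apply IsDerivator.der2
    intro a
    by_cases ha : a = x
    · subst ha
      have h₁ := (ranAdj D (pt a)).left_triangle_components G
      have : IsIso ((D.eval a).map ((ranAdj D (pt a)).unit.app G) ≫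
          (ranAdj D (pt a)).counit.app ((D.eval a).obj G)) := by
        rw [h₁]
        exact IsIso.id _
      exact IsIso.of_isIso_comp_right _ ((ranAdj D (pt a)).counit.app ((D.eval a).obj G))
    · have := hx a ha
      exact isIso_of_isZero (h a ha) (isZero_eval_ran D a (pt x) _) _
  exact ⟨_, ⟨(asIso ((ranAdj D (pt x)).unit.app G)).symm⟩⟩

/-- A coherent diagram vanishing away from `y` is the extension by zero of its value at `y`, if `y`
has no maps to other objects. -/
lemma essImage_lan_pt [IsPointed D] (y : A) [(pt y).Full] [(pt y).Faithful]
    (hy : ∀ a, a ≠ y → IsEmpty (Comma (pt y) (pt a))) (G : D.diag A)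
    (h : ∀ a, a ≠ y → IsZero ((D.eval a).obj G)) : (lan D (pt y)).essImage G := by
  have := (lanFullyFaithful D (pt y)).full
  have := (lanFullyFaithful D (pt y)).faithful
  have : IsIso ((lanAdj D (pt y)).counit.app G) := by
    apply IsDerivator.der2
    intro a
    by_cases ha : a = y
    · subst ha
      have h₁ := (lanAdj D (pt a)).right_triangle_components G
      have : IsIso ((lanAdj D (pt a)).unit.app ((D.eval a).obj G) ≫
          (D.eval a).map ((lanAdj D (pt a)).counit.app G)) := by
        rw [h₁]
        exact IsIso.id _
      exact IsIso.of_isIso_comp_left ((lanAdj D (pt a)).unit.app ((D.eval a).obj G)) _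
    · have := hy a ha
      exact isIso_of_isZero (isZero_eval_lan_pt D a y _) (h a ha) _
  exact ⟨_, ⟨asIso ((lanAdj D (pt y)).counit.app G)⟩⟩

/-- The diagrams `g_! x_* W` are the left Kan extensions along `g` that vanish at the images of all
objects other than `x`. For `g` the inclusion of the span these are the cocartesian squares with zero
off-diagonal corners. -/
lemma essImage_ran_lan_iff [IsPointed D] (g : A ⥤ B) [g.Full] [g.Faithful] (x : A) [(pt x).Full]
    [(pt x).Faithful] (hx : ∀ a, a ≠ x → IsEmpty (Comma (pt a) (pt x))) (X : D.diag B) :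
    (ran D (pt x) ⋙ lan D g).essImage X ↔
      (lan D g).essImage X ∧ ∀ a, a ≠ x → IsZero ((D.eval (g.obj a)).obj X) := by
  constructor
  · rintro ⟨W, ⟨e⟩⟩
    refine ⟨⟨_, ⟨e⟩⟩, fun a ha => ?_⟩
    have := hx a ha
    exact (isZero_eval_ran D a (pt x) W).of_iso
      ((D.eval (g.obj a)).mapIso e.symm ≪≫ (lanEvalIso D g a).app _)
  · rintro ⟨⟨G, ⟨e⟩⟩, h⟩
    obtain ⟨W, ⟨e'⟩⟩ := essImage_ran_pt D x hx G fun a ha => (h a ha).of_iso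
      ((lanEvalIso D g a).symm.app G ≪≫ (D.eval (g.obj a)).mapIso e)
    exact ⟨W, ⟨(lan D g).mapIso e' ≪≫ e⟩⟩

/-- The diagrams `g_* y_! W` are the right Kan extensions along `g` that vanish at the images of all
objects other than `y`. For `g` the inclusion of the cospan these are the cartesian squares with zero
off-diagonal corners. -/
lemma essImage_lan_ran_iff [IsPointed D] (g : A ⥤ B) [g.Full] [g.Faithful] (y : A) [(pt y).Full]
    [(pt y).Faithful] (hy : ∀ a, a ≠ y → IsEmpty (Comma (pt y) (pt a))) (X : D.diag B) :
    (lan D (pt y) ⋙ ran D g).essImage X ↔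
      (ran D g).essImage X ∧ ∀ a, a ≠ y → IsZero ((D.eval (g.obj a)).obj X) := by
  constructor
  · rintro ⟨W, ⟨e⟩⟩
    refine ⟨⟨_, ⟨e⟩⟩, fun a ha => ?_⟩
    have := hy a ha
    exact (isZero_eval_lan_pt D a y W).of_iso
      ((D.eval (g.obj a)).mapIso e.symm ≪≫ (ranEvalIso D g a).app _)
  · rintro ⟨⟨G, ⟨e⟩⟩, h⟩
    obtain ⟨W, ⟨e'⟩⟩ := essImage_lan_pt D y hy G fun a ha => (h a ha).of_iso
      ((ranEvalIso D g a).symm.app G ≪≫ (D.eval (g.obj a)).mapIso e)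
    exact ⟨W, ⟨(ran D g).mapIso e' ≪≫ e⟩⟩

end Suspension

section Square

instance full_pt {P : Type w} [Preorder P] (x : P) : (pt x).Full where
  map_surjective _ := ⟨Discrete.eqToHom (Subsingleton.elim _ _), Subsingleton.elim _ _⟩

instance faithful_pt {P : Type w} [Preorder P] (x : P) : (pt x).Faithful where

lemma isEmpty_comma_pt {P : Type w} [Preorder P] {x y : P} (h : ¬ x ≤ y) :
    IsEmpty (Comma (pt x) (pt y)) :=
  ⟨fun f => h (leOfHom f.hom)⟩

instance full_upperIncl : upperIncl.{w}.Full where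
  map_surjective f := ⟨homOfLE (leOfHom f), Subsingleton.elim _ _⟩

instance faithful_upperIncl : upperIncl.{w}.Faithful where
  map_injective _ := Subsingleton.elim _ _

instance full_lowerIncl : lowerIncl.{w}.Full where
  map_surjective f := ⟨homOfLE (leOfHom f), Subsingleton.elim _ _⟩

instance faithful_lowerIncl : lowerIncl.{w}.Faithful where
  map_injective _ := Subsingleton.elim _ _

/-- The apex `(0,0)` of the span `□ ∖ {(1,1)}`. -/
abbrev upperApex : UpperCorner.{w} := ⟨sq 0 0, by simp⟩

/-- The apex `(1,1)` of the cospan `□ ∖ {(0,0)}`. -/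
abbrev lowerApex : LowerCorner.{w} := ⟨sq 1 1, by simp⟩

lemma ne_upperApex (a : UpperCorner.{w}) (h : a ≠ upperApex) : a.1 = sq 0 1 ∨ a.1 = sq 1 0 := by
  obtain ⟨⟨i, j⟩, ha⟩ := a
  have hi : i = 0 ∨ i = 1 := by omega
  have hj : j = 0 ∨ j = 1 := by omega
  rcases hi with rfl | rfl <;> rcases hj with rfl | rfl <;>
    first | exact absurd rfl ha | simp_all

lemma ne_lowerApex (a : LowerCorner.{w}) (h : a ≠ lowerApex) : a.1 = sq 0 1 ∨ a.1 = sq 1 0 := by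
  obtain ⟨⟨i, j⟩, ha⟩ := a
  have hi : i = 0 ∨ i = 1 := by omega
  have hj : j = 0 ∨ j = 1 := by omega
  rcases hi with rfl | rfl <;> rcases hj with rfl | rfl <;>
    first | exact absurd rfl ha | simp_all

lemma isEmpty_comma_upperApex (a : UpperCorner.{w}) (h : a ≠ upperApex) :
    IsEmpty (Comma (pt a) (pt upperApex)) := by
  apply isEmpty_comma_pt
  intro (h' : a.1 ≤ sq 0 0)
  rcases ne_upperApex a h with h | h <;> simp [h] at h'

lemma isEmpty_comma_lowerApex (a : LowerCorner.{w}) (h : a ≠ lowerApex) :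
    IsEmpty (Comma (pt lowerApex) (pt a)) := by
  apply isEmpty_comma_pt
  intro (h' : sq 1 1 ≤ a.1)
  rcases ne_lowerApex a h with h | h <;> simp [h] at h'

/-- The object `(1,1)` is terminal in the square. -/
def isTerminalSq : IsTerminal (sq.{w} 1 1) :=
  IsTerminal.ofUniqueHom (fun a => homOfLE ⟨Fin.le_last a.down.1, Fin.le_last a.down.2⟩)
    fun _ _ => Subsingleton.elim _ _

variable (D : Prederivator.{w, v, u}) [IsDerivator D]

/-- The coherent span `(0 ⟵ X ⟶ 0)`, indexed by `□ ∖ {(1,1)}`. -/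
noncomputable abbrev zeroSpan : D.diag One.{w} ⥤ D.diag UpperCorner.{w} := ran D (pt upperApex)

/-- The suspension `Σ X`, the homotopy colimit of `(0 ⟵ X ⟶ 0)`. -/
noncomputable def suspension : D.diag One.{w} ⥤ D.diag One.{w} :=
  zeroSpan D ⋙ lan D (toOne UpperCorner.{w})

/-- The homotopy colimit over `□ ∖ {(1,1)}` is the value at `(1,1)` of the left Kan extension to
the square. -/
noncomputable def lanUpperInclEvalIso :
    lan D upperIncl.{w} ⋙ D.eval (sq 1 1) ≅ lan D (toOne UpperCorner.{w}) :=
  let adj := (lanAdj D upperIncl.{w}).comp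
    (resAdj D (terminalAdj (toOne Square.{w}) isTerminalSq))
  let e : D.res (toOne Square.{w}) ⋙ D.res upperIncl.{w} ≅ D.res (toOne UpperCorner.{w}) :=
    (D.resComp _ _).symm ≪≫ resMapIso D (isoOne _ _)
  (adj.ofNatIsoRight e).leftAdjointUniq (lanAdj D _)

instance isEquivalence_suspension [IsSigmaStable D] : (suspension D).IsEquivalence := by
  have := (ranFullyFaithful D (pt upperApex.{w})).full
  have := (ranFullyFaithful D (pt upperApex.{w})).faithful
  have := (lanFullyFaithful D upperIncl.{w}).full
  have := (lanFullyFaithful D upperIncl.{w}).faithful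
  have := (lanFullyFaithful D (pt lowerApex.{w})).full
  have := (lanFullyFaithful D (pt lowerApex.{w})).faithful
  have := (ranFullyFaithful D lowerIncl.{w}).full
  have := (ranFullyFaithful D lowerIncl.{w}).faithful
  have hU (X : D.diag Square.{w}) :
      (∀ a, a ≠ upperApex → IsZero ((D.eval (upperIncl.obj a)).obj X)) ↔
        IsZero ((D.eval (sq 0 1)).obj X) ∧ IsZero ((D.eval (sq 1 0)).obj X) := by
    refine ⟨fun h => ⟨h ⟨sq 0 1, by simp⟩ (by simp), h ⟨sq 1 0, by simp⟩ (by simp)⟩, ?_⟩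
    rintro ⟨h₁, h₂⟩ a ha
    change IsZero ((D.eval a.1).obj X)
    rcases ne_upperApex a ha with h | h <;> rw [h] <;> assumption
  have hL (X : D.diag Square.{w}) :
      (∀ a, a ≠ lowerApex → IsZero ((D.eval (lowerIncl.obj a)).obj X)) ↔
        IsZero ((D.eval (sq 0 1)).obj X) ∧ IsZero ((D.eval (sq 1 0)).obj X) := by
    refine ⟨fun h => ⟨h ⟨sq 0 1, by simp⟩ (by simp), h ⟨sq 1 0, by simp⟩ (by simp)⟩, ?_⟩
    rintro ⟨h₁, h₂⟩ a ha
    change IsZero ((D.eval a.1).obj X)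
    rcases ne_lowerApex a ha with h | h <;> rw [h] <;> assumption
  have h : (ran D (pt upperApex.{w}) ⋙ lan D upperIncl.{w}).essImage =
      (lan D (pt lowerApex.{w}) ⋙ ran D lowerIncl.{w}).essImage := by
    ext X
    rw [essImage_ran_lan_iff D _ _ isEmpty_comma_upperApex,
      essImage_lan_ran_iff D _ _ isEmpty_comma_lowerApex, hU, hL]
    constructor
    · rintro ⟨hX, h₁, h₂⟩
      exact ⟨(IsSigmaStable.cartesian_iff_cocartesian X h₁ h₂).2 hX, h₁, h₂⟩
    · rintro ⟨hX, h₁, h₂⟩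
      exact ⟨(IsSigmaStable.cartesian_iff_cocartesian X h₁ h₂).1 hX, h₁, h₂⟩
  let e : (lan D (pt lowerApex.{w}) ⋙ ran D lowerIncl.{w}) ⋙ D.eval (sq 1 1) ≅ 𝟭 _ :=
    Functor.associator _ _ _ ≪≫
      Functor.isoWhiskerLeft _ (ranEvalIso D lowerIncl.{w} lowerApex) ≪≫
      (asIso (lanAdj D (pt lowerApex.{w})).unit).symm
  have := isEquivalence_comp_of_essImage_eq _ _ h _ e
  exact Functor.isEquivalence_of_iso (Functor.associator _ _ _ ≪≫
    Functor.isoWhiskerLeft _ (lanUpperInclEvalIso D))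

end Square

/-! ### The subdivided span -/

section Fence

/-- The subdivision `(0,2) ⟵ (0,1) ⟶ (1,1) ⟵ (1,0) ⟶ (2,0)` of the span `□ ∖ {(1,1)}`, realised as
a subset of a `3 × 3` grid. -/
abbrev Fence : Type w :=
  ULift.{w} {z : Fin 3 × Fin 3 // 1 ≤ (z.1 : ℕ) + z.2 ∧ (z.1 : ℕ) + z.2 ≤ 2}

/-- The monotone surjection `Fin 3 ⟶ Fin 2` sending `1` to `0`. -/
def half : Fin 3 →o Fin 2 := ⟨![0, 0, 1], by intro a b; revert a b; decide⟩

/-- The monotone surjection `Fin 3 ⟶ Fin 2` sending `1` to `1`. -/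
def cap : Fin 3 →o Fin 2 := ⟨![0, 1, 1], by intro a b; revert a b; decide⟩

/-- The functor `(a, b) ↦ (f a, g b)` from the subdivided span to the span. -/
def fenceMap (f g : Fin 3 →o Fin 2)
    (h : ∀ a b : Fin 3, (a : ℕ) + b ≤ 2 → f a = 1 → g b ≠ 1) : Fence.{w} ⥤ UpperCorner.{w} :=
  Monotone.functor
    (f := fun z => ⟨sq (f z.down.1.1) (g z.down.1.2), fun e =>
      h _ _ z.down.2.2 (congrArg (fun s => s.down.1) e) (congrArg (fun s => s.down.2) e)⟩)
    (fun _ _ h => ⟨f.monotone h.1, g.monotone h.2⟩)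

/-- The collapse of the subdivided span onto the span, sending the three inner objects to the
apex. -/
def collapse : Fence.{w} ⥤ UpperCorner.{w} := fenceMap half half (by decide)

/-- The map that is a bijection from the first half `(0,2) ⟵ (0,1) ⟶ (1,1)` to the span, and
constant on the second half. -/
def firstHalf : Fence.{w} ⥤ UpperCorner.{w} := fenceMap cap half (by decide)

/-- The map that is a bijection from the second half `(1,1) ⟵ (1,0) ⟶ (2,0)` to the span, and
constant on the first half. -/
def secondHalf : Fence.{w} ⥤ UpperCorner.{w} := fenceMap half cap (by decide)

lemma half_le_cap (a : Fin 3) : half a ≤ cap a := by revert a; decide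

/-- The comparison of the collapse with the first half. -/
def collapseToFirst : collapse.{w} ⟶ firstHalf where
  app z := homOfLE ⟨half_le_cap _, le_rfl⟩

/-- The comparison of the collapse with the second half. -/
def collapseToSecond : collapse.{w} ⟶ secondHalf where
  app z := homOfLE ⟨le_rfl, half_le_cap _⟩

/-- The two halves of the subdivided span have no apex in common. -/
lemma firstHalf_ne_or_secondHalf_ne (z : Fence.{w}) :
    firstHalf.obj z ≠ upperApex ∨ secondHalf.obj z ≠ upperApex := by
  have key : ∀ a b : Fin 3, 1 ≤ (a : ℕ) + b →
      ¬ ((cap a = 0 ∧ half b = 0) ∧ half a = 0 ∧ cap b = 0) := by decide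
  by_contra! h
  have h₁ := congrArg (fun s => s.1.down) h.1
  have h₂ := congrArg (fun s => s.1.down) h.2
  exact key _ _ z.down.2.1 ⟨Prod.ext_iff.1 h₁, Prod.ext_iff.1 h₂⟩

end Fence

section Contraction

variable (D : Prederivator.{w, v, u})

/-- For preorders, a contraction of the comma category `(k/c)` amounts to an order-theoretic one of
the up-set `{z | k ≤ c z}`. -/
lemma bijective_res_comma_fst {P Q : Type w} [Preorder P] [Preorder Q] (c : P ⥤ Q) (k : Q)
    (ρ : P →o P) (m : P) (hm : k ≤ c.obj m)
    (hρ : ∀ z, k ≤ c.obj z → k ≤ c.obj (ρ z) ∧ ρ z ≤ z ∧ ρ z ≤ m) (X Y : D.diag One.{w}) :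
    Function.Bijective (fun f : X ⟶ Y => (D.res (Comma.fst (pt k) c)).map f) := by
  let E := Comma (pt k) c
  have hE (x : E) : k ≤ c.obj x.right := leOfHom x.hom
  let mor {x y : E} (h : x.right ≤ y.right) : x ⟶ y :=
    { left := Discrete.eqToHom (Subsingleton.elim _ _)
      right := homOfLE h }
  have thin {x y : E} (f g : x ⟶ y) : f = g := by
    ext
    · exact Subsingleton.elim _ _
    · exact Subsingleton.elim _ _
  let r : E ⥤ E :=
    { obj := fun x => Comma.mk (L := pt k) (R := c) ⟨PUnit.unit⟩ (ρ x.right)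
        (homOfLE (hρ _ (hE x)).1)
      map := fun f => mor (ρ.monotone (leOfHom f.right))
      map_id := fun _ => thin _ _
      map_comp := fun _ _ => thin _ _ }
  exact bijective_res_map_of_contraction D _ r
    (Comma.mk (L := pt k) (R := c) ⟨PUnit.unit⟩ m (homOfLE hm))
    { app := fun x => mor (hρ _ (hE x)).2.1
      naturality := fun _ _ _ => thin _ _ }
    { app := fun x => mor (hρ _ (hE x)).2.2
      naturality := fun _ _ _ => thin _ _ } X Y

/-- The endomorphism `(a, b) ↦ (min a 1, min b 1)` of the subdivided span, moving both ends one step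
inwards. -/
def fenceRetract : Fence.{w} →o Fence.{w} where
  toFun z := ⟨⟨(min z.down.1.1 1, min z.down.1.2 1), by
    obtain ⟨⟨⟨a, b⟩, h⟩⟩ := z
    revert a b
    decide⟩⟩
  monotone' _ _ h := ⟨min_le_min_right 1 h.1, min_le_min_right 1 h.2⟩

/-- All the comma categories of the collapse are contractible. -/
lemma bijective_res_comma_collapse (k : UpperCorner.{w}) (X Y : D.diag One.{w}) :
    Function.Bijective (fun f : X ⟶ Y => (D.res (Comma.fst (pt k) collapse)).map f) := by
  by_cases hk : k = upperApex
  · subst hk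
    have h₀ (z : UpperCorner.{w}) : upperApex ≤ z := ⟨Fin.zero_le _, Fin.zero_le _⟩
    exact bijective_res_comma_fst D collapse upperApex fenceRetract ⟨⟨(1, 1), by decide⟩⟩ (h₀ _)
      (fun z _ => ⟨h₀ _, ⟨min_le_left _ _, min_le_left _ _⟩, ⟨min_le_right _ _, min_le_right _ _⟩⟩)
      X Y
  · obtain ⟨k, hk'⟩ := k
    rcases ne_upperApex _ hk with h | h
    · obtain rfl : k = sq 0 1 := h
      have key : ∀ a b : Fin 3, (a : ℕ) + b ≤ 2 → 1 ≤ half b → a ≤ 0 ∧ b ≤ 2 := by decide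
      exact bijective_res_comma_fst D collapse _ OrderHom.id ⟨⟨(0, 2), by decide⟩⟩
        ⟨Fin.zero_le _, le_rfl⟩ (fun z hz => ⟨hz, le_rfl, key _ _ z.down.2.2 hz.2⟩) X Y
    · obtain rfl : k = sq 1 0 := h
      have key : ∀ a b : Fin 3, (a : ℕ) + b ≤ 2 → 1 ≤ half a → a ≤ 2 ∧ b ≤ 0 := by decide
      exact bijective_res_comma_fst D collapse _ OrderHom.id ⟨⟨(2, 0), by decide⟩⟩
        ⟨le_rfl, Fin.zero_le _⟩ (fun z hz => ⟨hz, le_rfl, key _ _ z.down.2.2 hz.1⟩) X Y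

end Contraction

/-! ### Addition of maps out of a suspension -/

section Transpose

variable (D : Prederivator.{w, v, u}) [IsDerivator D]

/-- Maps `Σ X ⟶ Y` are maps from `(0 ⟵ X ⟶ 0)` to the constant diagram on `Y`. -/
noncomputable def transpose {X Y : D.diag One.{w}} :
    ((suspension D).obj X ⟶ Y) ≃ ((zeroSpan D).obj X ⟶ (D.res (toOne _)).obj Y) :=
  (lanAdj D (toOne UpperCorner.{w})).homEquiv ((zeroSpan D).obj X) Y

lemma transpose_comp {X Y Y' : D.diag One.{w}} (f : (suspension D).obj X ⟶ Y) (h : Y ⟶ Y') :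
    transpose D (f ≫ h) = transpose D f ≫ (D.res (toOne _)).map h :=
  (lanAdj D (toOne _)).homEquiv_naturality_right _ _

lemma transpose_suspension_map_comp {X X' Y : D.diag One.{w}} (k : X' ⟶ X)
    (f : (suspension D).obj X ⟶ Y) :
    transpose D ((suspension D).map k ≫ f) = (zeroSpan D).map k ≫ transpose D f :=
  (lanAdj D (toOne _)).homEquiv_naturality_left _ _

/-- Maps `Σ X ⟶ Y`, as maps to a constant diagram on the subdivided span. -/
noncomputable def fenceTranspose {X Y : D.diag One.{w}} :
    ((suspension D).obj X ⟶ Y) ≃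
      ((D.res collapse).obj ((zeroSpan D).obj X) ⟶
        (D.res collapse).obj ((D.res (toOne _)).obj Y)) :=
  (transpose D).trans (Equiv.ofBijective _ (bijective_res_map_of_comma D collapse (toOne _)
    (bijective_res_comma_collapse D) _ Y))

lemma fenceTranspose_apply {X Y : D.diag One.{w}} (f : (suspension D).obj X ⟶ Y) :
    fenceTranspose D f = (D.res collapse).map (transpose D f) :=
  rfl

end Transpose

section Sum

attribute [local instance] HasZeroObject.zeroMorphismsOfZeroObject

instance preservesZeroMorphisms_res (D : Prederivator.{w, v, u}) [IsDerivator D] [IsPointed D]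
    {A B : Type w} [SmallCategory A] [SmallCategory B] (p : A ⥤ B) :
    (D.res p).PreservesZeroMorphisms :=
  Functor.preservesZeroMorphisms_of_isLeftAdjoint _

variable (D : Prederivator.{w, v, u}) [IsDerivator D] [IsPointed D]

/-- At each object of the subdivided span, one of the two restrictions of `(0 ⟵ X ⟶ 0)` vanishes. -/
instance isIso_coprodToProd_halves (X : D.diag One.{w}) :
    IsIso (coprodToProd ((D.res firstHalf).obj ((zeroSpan D).obj X))
      ((D.res secondHalf).obj ((zeroSpan D).obj X))) := by
  apply IsDerivator.der2
  intro z
  rw [isIso_map_coprodToProd_iff]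
  have key (c : Fence.{w} ⥤ UpperCorner.{w}) (hc : c.obj z ≠ upperApex) :
      IsZero ((D.eval z).obj ((D.res c).obj ((zeroSpan D).obj X))) := by
    have := isEmpty_comma_upperApex _ hc
    exact (isZero_eval_ran D (c.obj z) (pt upperApex) X).of_iso
      (((D.resComp (pt z) c).symm ≪≫ resMapIso D (ptComp z c)).app _)
  rcases firstHalf_ne_or_secondHalf_ne z with h | h
  · exact isIso_coprodToProd_of_isZero_left (key _ h)
  · exact isIso_coprodToProd_of_isZero_right (key _ h)

instance isIso_resMap_app_const {A B : Type w} [SmallCategory A] [SmallCategory B] {c d : A ⥤ B}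
    (κ : c ⟶ d) (p : B ⥤ One.{w}) (Y : D.diag One.{w}) :
    IsIso ((D.resMap κ).app ((D.res p).obj Y)) :=
  isIso_resMap_app_res D κ p Y

section FenceSum

variable {M M' : D.diag UpperCorner.{w}} {Y Y' : D.diag One.{w}}
  [IsIso (coprodToProd ((D.res firstHalf).obj M) ((D.res secondHalf).obj M))]
  [IsIso (coprodToProd ((D.res firstHalf).obj M') ((D.res secondHalf).obj M'))]

/-- The concatenation of `f` and `g`: the map from the subdivision of `M` to a constant diagram which
is given by `f` on the first half and by `g` on the second half. All restrictions of a constant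
diagram are identified with its restriction along `collapse`, by the inverses of the comparison
maps. -/
noncomputable def fenceSum (f g : M ⟶ (D.res (toOne _)).obj Y) :
    (D.res collapse).obj M ⟶ (D.res collapse).obj ((D.res (toOne _)).obj Y) :=
  prod.lift ((D.resMap collapseToFirst).app M) ((D.resMap collapseToSecond).app M) ≫
    inv (coprodToProd _ _) ≫
    coprod.desc ((D.res firstHalf).map f ≫ inv ((D.resMap collapseToFirst).app _))
      ((D.res secondHalf).map g ≫ inv ((D.resMap collapseToSecond).app _))

lemma fenceSum_zero (f : M ⟶ (D.res (toOne _)).obj Y) :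
    fenceSum D f 0 = (D.res collapse).map f := by
  have h : coprod.desc ((D.res firstHalf).map f ≫ inv ((D.resMap collapseToFirst).app _))
      ((D.res secondHalf).map (0 : M ⟶ (D.res (toOne _)).obj Y) ≫
        inv ((D.resMap collapseToSecond).app _)) =
      coprodToProd _ _ ≫ prod.fst ≫ (D.res firstHalf).map f ≫
        inv ((D.resMap collapseToFirst).app _) := by
    ext <;> simp [prod.lift_fst_assoc, coprod.inl_desc, coprod.inr_desc]
  rw [fenceSum, h, IsIso.inv_hom_id_assoc, prod.lift_fst_assoc, ← Category.assoc,
    IsIso.comp_inv_eq, NatTrans.naturality]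

lemma zero_fenceSum (f : M ⟶ (D.res (toOne _)).obj Y) :
    fenceSum D 0 f = (D.res collapse).map f := by
  have h : coprod.desc ((D.res firstHalf).map (0 : M ⟶ (D.res (toOne _)).obj Y) ≫
        inv ((D.resMap collapseToFirst).app _))
      ((D.res secondHalf).map f ≫ inv ((D.resMap collapseToSecond).app _)) =
      coprodToProd _ _ ≫ prod.snd ≫ (D.res secondHalf).map f ≫
        inv ((D.resMap collapseToSecond).app _) := by
    ext <;> simp [prod.lift_snd_assoc, coprod.inl_desc, coprod.inr_desc]
  rw [fenceSum, h, IsIso.inv_hom_id_assoc, prod.lift_snd_assoc, ← Category.assoc,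
    IsIso.comp_inv_eq, NatTrans.naturality]

lemma fenceSum_comp (f g : M ⟶ (D.res (toOne _)).obj Y) (h : Y ⟶ Y') :
    fenceSum D f g ≫ (D.res collapse).map ((D.res (toOne _)).map h) =
      fenceSum D (f ≫ (D.res (toOne _)).map h) (g ≫ (D.res (toOne _)).map h) := by
  have key {c d : Fence.{w} ⥤ UpperCorner.{w}} (κ : c ⟶ d) :
      inv ((D.resMap κ).app ((D.res (toOne _)).obj Y)) ≫
        (D.res c).map ((D.res (toOne _)).map h) =
      (D.res d).map ((D.res (toOne _)).map h) ≫
        inv ((D.resMap κ).app ((D.res (toOne _)).obj Y')) := by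
    rw [IsIso.inv_comp_eq, ← Category.assoc, IsIso.eq_comp_inv, NatTrans.naturality]
  simp only [fenceSum, Category.assoc, coprod.desc_comp, key, Functor.map_comp]

lemma comp_fenceSum (k : M' ⟶ M) (f g : M ⟶ (D.res (toOne _)).obj Y) :
    (D.res collapse).map k ≫ fenceSum D f g = fenceSum D (k ≫ f) (k ≫ g) := by
  have h₁ : (D.res collapse).map k ≫
      prod.lift ((D.resMap collapseToFirst).app M) ((D.resMap collapseToSecond).app M) =
      prod.lift ((D.resMap collapseToFirst).app M') ((D.resMap collapseToSecond).app M') ≫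
        prod.map ((D.res firstHalf).map k) ((D.res secondHalf).map k) := by
    ext <;> simp [prod.lift_fst, prod.lift_snd]
  have h₂ : prod.map ((D.res firstHalf).map k) ((D.res secondHalf).map k) ≫
      inv (coprodToProd _ _) = inv (coprodToProd _ _) ≫
        coprod.map ((D.res firstHalf).map k) ((D.res secondHalf).map k) := by
    rw [IsIso.comp_inv_eq, Category.assoc, coprodToProd_naturality, IsIso.inv_hom_id_assoc]
  rw [fenceSum, ← Category.assoc, h₁, Category.assoc, ← Category.assoc (prod.map _ _), h₂,
    Category.assoc, coprod.map_desc, fenceSum]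
  simp only [Functor.map_comp, Category.assoc]

end FenceSum

lemma transpose_zero {X Y : D.diag One.{w}} :
    transpose D (0 : (suspension D).obj X ⟶ Y) = 0 := by
  refine ((lanAdj D (toOne UpperCorner.{w})).homEquiv_unit _ _ _).trans ?_
  exact (congrArg _ (Functor.map_zero _ _ _)).trans comp_zero

/-- The addition on `Hom (Σ X, Y)` given by concatenation. Only its units and its naturality matter
here. -/
noncomputable def suspensionAdd {X Y : D.diag One.{w}} (f g : (suspension D).obj X ⟶ Y) :
    (suspension D).obj X ⟶ Y :=
  (fenceTranspose D).symm (fenceSum D (transpose D f) (transpose D g))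

lemma fenceTranspose_suspensionAdd {X Y : D.diag One.{w}} (f g : (suspension D).obj X ⟶ Y) :
    fenceTranspose D (suspensionAdd D f g) = fenceSum D (transpose D f) (transpose D g) :=
  (fenceTranspose D).apply_symm_apply _

lemma suspensionAdd_zero {X Y : D.diag One.{w}} (f : (suspension D).obj X ⟶ Y) :
    suspensionAdd D f 0 = f := by
  apply (fenceTranspose D).injective
  rw [fenceTranspose_suspensionAdd, transpose_zero, fenceSum_zero, fenceTranspose_apply]

lemma zero_suspensionAdd {X Y : D.diag One.{w}} (f : (suspension D).obj X ⟶ Y) :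
    suspensionAdd D 0 f = f := by
  apply (fenceTranspose D).injective
  rw [fenceTranspose_suspensionAdd, transpose_zero, zero_fenceSum, fenceTranspose_apply]

lemma suspensionAdd_comp {X Y Y' : D.diag One.{w}} (f g : (suspension D).obj X ⟶ Y)
    (h : Y ⟶ Y') : suspensionAdd D f g ≫ h = suspensionAdd D (f ≫ h) (g ≫ h) := by
  apply (fenceTranspose D).injective
  rw [fenceTranspose_suspensionAdd, transpose_comp, transpose_comp, ← fenceSum_comp,
    ← fenceTranspose_suspensionAdd, fenceTranspose_apply, fenceTranspose_apply, transpose_comp,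
    Functor.map_comp]

lemma comp_suspensionAdd {X X' Y : D.diag One.{w}} (k : X' ⟶ X)
    (f g : (suspension D).obj X ⟶ Y) :
    (suspension D).map k ≫ suspensionAdd D f g =
      suspensionAdd D ((suspension D).map k ≫ f) ((suspension D).map k ≫ g) := by
  apply (fenceTranspose D).injective
  rw [fenceTranspose_suspensionAdd, transpose_suspension_map_comp, transpose_suspension_map_comp,
    ← comp_fenceSum, ← fenceTranspose_suspensionAdd, fenceTranspose_apply, fenceTranspose_apply,
    transpose_suspension_map_comp, Functor.map_comp]

end Sum

/-! ### Additivity -/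

attribute [local instance] HasZeroObject.zeroMorphismsOfZeroObject in
lemma isIso_coprodToProd_diag (D : Prederivator.{w, v, u}) [IsDerivator D] [IsSigmaStable D]
    (A : Type w) [SmallCategory A] (X Y : D.diag A) :
    IsIso (coprodToProd X Y) := by
  apply IsDerivator.der2
  intro a
  rw [isIso_map_coprodToProd_iff]
  exact isIso_coprodToProd_of_add (suspension D) (suspensionAdd D) (suspensionAdd_zero D)
    (zero_suspensionAdd D) (suspensionAdd_comp D) (comp_suspensionAdd D) _ _

end Derivators

theorem mainTheorem9 (D : Derivators.Prederivator.{w, v, u}) [Derivators.IsDerivator D]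
    [Derivators.IsSigmaStable D] : Derivators.IsAdditive D := by
  intro A _
  exact Derivators.finiteProductsCoincide_of_isIso_coprodToProd _
    (Derivators.isIso_coprodToProd_diag D A)
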